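/- Let $\mathfrak g$ be a finite-dimensional simple complex Lie algebra, $\mathfrak h$ a Cartan subalgebra and $\Delta$ the set of roots of $\mathfrak h$ in $\mathfrak g$, with root spaces $\mathfrak g_\alpha$ ($\alpha\in\Delta$). Let $\langle\cdot,\cdot\rangle$ be the bilinear form on $\mathfrak h^*$ induced by the Killing form; it is real and positive definite on the real span of $\Delta$, and the length of a root is measured with it. Suppose that exactly two root lengths occur in $\Delta$. Let $\lambda_0$ be an element of the real span of $\Delta$, and let $$\mathfrak q=\mathfrak h\oplus\bigoplus_{\alpha\in\Delta,\ \langle\lambda_0,\alpha\rangle\le 0}\mathfrak g_\alpha,\qquad \Delta(\mathfrak u)=\{\alpha\in\Delta:\langle\lambda_0,\alpha\rangle>0\},$$ so that $\mathfrak q$ is a parabolic subalgebra and $\mathfrak u=\bigoplus_{\alpha\in\Delta(\mathfrak u)}\mathfrak g_\alpha$ is the nilradical of the opposite parabolic subalgebra. Let $\Delta^+\subset\Delta$ be a positive system with $\Delta(\mathfrak u)\subset\Delta^+$. Let $\gamma_s$ be the $\Delta^+$-dominant short root, and let $E_{\gamma_s}$ be the irreducible finite-dimensional representation of $\mathfrak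 g$ with highest weight $\gamma_s$ (with respect to $\Delta^+$). **Lemma 3.1.** Suppose there are roots $\beta_1,\dots,\beta_m\in\Delta^+$, not necessarily distinct, such that $\gamma_s-\sum_{j=1}^k\beta_j$ is a root for each $k=1,\dots,m$, and $\gamma_s-\sum_{j=1}^m\beta_j$ is a long root belonging to $\Delta(\mathfrak u)$. Then $$\operatorname{Hom}_{\mathfrak q}(E_{\gamma_s},\mathfrak g/\mathfrak q)=0,$$ that is, every $\mathfrak q$-equivariant linear map $E_{\gamma_s}\to\mathfrak g/\mathfrak q$ is zero. -/

import Mathlib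

open LieAlgebra LieModule LieAlgebra.IsKilling

noncomputable section

namespace ParabolicHom

variable {L : Type*} [LieRing L] [LieAlgebra ℂ L] [FiniteDimensional ℂ L] [IsKilling ℂ L]
  (H : LieSubalgebra ℂ L) [H.IsCartanSubalgebra]

/-- The set `Δ = Δ(𝔥, 𝔤)` of roots, as linear forms on the Cartan subalgebra `𝔥`. -/
def roots : Set (Module.Dual ℂ H) := Set.range (rootSystem H).root

/-- The real span of the roots in the dual of `𝔥`. -/
def realDual : Submodule ℝ (Module.Dual ℂ H) := Submodule.span ℝ (roots H)

/-- The bilinear form `⟨μ, ν⟩ = κ(t_μ, t_ν)` on the dual of `𝔥` induced by the Killing form `κ`,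
where `t_μ ∈ 𝔥` is determined by `κ(t_μ, h) = μ(h)` for all `h ∈ 𝔥`. -/
def dualForm (μ ν : Module.Dual ℂ H) : ℂ :=
  killingForm ℂ L ((cartanEquivDual H).symm μ : L) ((cartanEquivDual H).symm ν : L)

/-- The real number `⟨μ, ν⟩` for `μ, ν` in the real span of the roots (where the form induced by
the Killing form takes real values). -/
def realForm (μ ν : Module.Dual ℂ H) : ℝ := (dualForm H μ ν).re

/-- The squared length `⟨μ, μ⟩`. -/
def sqLength (μ : Module.Dual ℂ H) : ℝ := realForm H μ μ

/-- Exactly two different lengths occur among the roots. -/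
def HasTwoRootLengths : Prop := (sqLength H '' roots H).ncard = 2

/-- `μ` is a long root: a root of maximal length. -/
def IsLongRoot (μ : Module.Dual ℂ H) : Prop :=
  μ ∈ roots H ∧ ∀ ν ∈ roots H, sqLength H ν ≤ sqLength H μ

/-- `μ` is a short root: a root of minimal length. -/
def IsShortRoot (μ : Module.Dual ℂ H) : Prop :=
  μ ∈ roots H ∧ ∀ ν ∈ roots H, sqLength H μ ≤ sqLength H ν

variable {H} in
/-- The positive system `Δ⁺` determined by a choice of simple roots. -/
def posRoots (b : (rootSystem H).Base) : Set (Module.Dual ℂ H) :=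
  (rootSystem H).root '' {i | b.IsPos i}

variable {H} in
/-- `μ` is dominant for the positive system of `b`. -/
def IsDominant (b : (rootSystem H).Base) (μ : Module.Dual ℂ H) : Prop :=
  ∀ α ∈ posRoots b, 0 ≤ realForm H μ α

/-- The roots of the parabolic subalgebra `𝔮 = 𝔮(lam)`: those with `⟨lam, α⟩ ≤ 0`. -/
def parabolicRoots (lam : Module.Dual ℂ H) : Set (Module.Dual ℂ H) :=
  {α ∈ roots H | realForm H lam α ≤ 0}

/-- The roots `Δ(𝔲)` of the nilradical `𝔲` of the parabolic subalgebra opposite to `𝔮(lam)`: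
those with `⟨lam, α⟩ > 0`. (The Levi factor of `𝔮(lam)` has the roots with `⟨lam, α⟩ = 0`, its
nilradical those with `⟨lam, α⟩ < 0`.) -/
def oppNilRoots (lam : Module.Dual ℂ H) : Set (Module.Dual ℂ H) :=
  {α ∈ roots H | 0 < realForm H lam α}

lemma realForm_add (lam μ ν : Module.Dual ℂ H) :
    realForm H lam (μ + ν) = realForm H lam μ + realForm H lam ν := by
  simp [realForm, dualForm]

lemma realForm_zero (lam : Module.Dual ℂ H) : realForm H lam 0 = 0 := by
  simp [realForm, dualForm]

/-- The underlying space of `𝔮(lam)`: the sum of `𝔥` and of the root spaces of the roots `α` with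
`⟨lam, α⟩ ≤ 0`. -/
def parabolicSubmodule (lam : Module.Dual ℂ H) : Submodule ℂ L :=
  H.toSubmodule ⊔ ⨆ α ∈ parabolicRoots H lam, (rootSpace H (α : H → ℂ)).toSubmodule

lemma parabolicSubmodule_eq (lam : Module.Dual ℂ H) :
    parabolicSubmodule H lam =
      ⨆ μ : {μ : Module.Dual ℂ H // realForm H lam μ ≤ 0},
        (rootSpace H (μ.1 : H → ℂ)).toSubmodule := by
  have hH : H.toSubmodule = (rootSpace H ((0 : Module.Dual ℂ H) : H → ℂ)).toSubmodule := by
    ext x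
    change x ∈ H ↔ x ∈ rootSpace H (0 : H → ℂ)
    rw [← LieSubalgebra.mem_toLieSubmodule, rootSpace_zero_eq ℂ L H]
  apply le_antisymm
  · refine sup_le ?_ (iSup₂_le fun α hα => ?_)
    · rw [hH]
      exact le_iSup (fun μ : {μ : Module.Dual ℂ H // realForm H lam μ ≤ 0} =>
        (rootSpace H (μ.1 : H → ℂ)).toSubmodule) ⟨0, (realForm_zero H lam).le⟩
    · exact le_iSup (fun μ : {μ : Module.Dual ℂ H // realForm H lam μ ≤ 0} =>
        (rootSpace H (μ.1 : H → ℂ)).toSubmodule) ⟨α, hα.2⟩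
  · refine iSup_le fun ⟨μ, hμ⟩ => ?_
    by_cases h0 : μ = 0
    · subst h0
      rw [← hH]
      exact le_sup_left
    by_cases hb : rootSpace H (μ : H → ℂ) = ⊥
    · simp [hb]
    · let w : Weight ℂ H L := ⟨μ, hb⟩
      have hw : w ∈ H.root := by
        simp only [Finset.mem_filter, Finset.mem_univ, true_and]
        intro h
        exact h0 (by ext x; exact congrFun h x)
      refine le_sup_of_le_right (le_iSup₂_of_le μ ⟨⟨⟨w, hw⟩, ?_⟩, hμ⟩ le_rfl)
      ext x
      rfl

/-- The parabolic subalgebra `𝔮 = 𝔮(lam)`, the sum of `𝔥` and of the root spaces of the roots `α`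
with `⟨lam, α⟩ ≤ 0`. -/
def parabolic (lam : Module.Dual ℂ H) : LieSubalgebra ℂ L where
  toSubmodule := parabolicSubmodule H lam
  lie_mem' := by
    intro x y hx hy
    change x ∈ parabolicSubmodule H lam at hx
    change y ∈ parabolicSubmodule H lam at hy
    change ⁅x, y⁆ ∈ parabolicSubmodule H lam
    rw [parabolicSubmodule_eq] at hx hy ⊢
    induction hx using Submodule.iSup_induction' with
    | zero => simp
    | add x₁ x₂ _ _ h₁ h₂ => rw [add_lie]; exact add_mem h₁ h₂
    | mem μ x hx =>
      induction hy using Submodule.iSup_induction' with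
      | zero => simp
      | add y₁ y₂ _ _ h₁ h₂ => rw [lie_add]; exact add_mem h₁ h₂
      | mem ν y hy =>
        refine Submodule.mem_iSup_of_mem ⟨μ.1 + ν.1, ?_⟩ ?_
        · rw [realForm_add]
          exact add_nonpos μ.2 ν.2
        · exact lie_mem_genWeightSpace_of_mem_genWeightSpace hx hy

variable {H} in
/-- `E` is an irreducible finite-dimensional representation of `𝔤` with highest weight `γ`:
it has a nonzero vector of weight `γ` that is annihilated by all positive root spaces. -/
structure IsIrrepOfHighestWeight (b : (rootSystem H).Base) (γ : Module.Dual ℂ H)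
    (E : Type*) [AddCommGroup E] [Module ℂ E] [LieRingModule L E] [LieModule ℂ L E] : Prop where
  finiteDimensional : FiniteDimensional ℂ E
  irreducible : LieModule.IsIrreducible ℂ L E
  exists_highestWeightVector : ∃ v : E, v ≠ 0 ∧ (∀ h : H, ⁅(h : L), v⁆ = γ h • v) ∧
    ∀ α ∈ posRoots b, ∀ x ∈ rootSpace H (α : H → ℂ), ⁅x, v⁆ = 0

end ParabolicHom

end

/-! Let `v` be the highest weight vector of `E`. Since Δ(𝔲) ⊆ Δ⁺, all negative root spaces lie in 𝔮.
A 𝔮-map `φ` respects weights and 𝔲 is an 𝔥-stable complement of 𝔮, so `φ v` is the class of some `x`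
in the root space of `γ`.

Suppose `x ≠ 0`. Bracketing successively with suitable root vectors for `-β j` keeps the root vector
nonzero at each stage, by 𝔰𝔩₂-theory (`exists_lie_ne_zero`). It ends at a nonzero `y` whose root is
long and lies in Δ(𝔲), so the class of `y` is nonzero. The same operators applied to `v` give a
vector `u` of that long weight with `φ u` equal to this class. But no weight of `E` is longer than
`γ` (`IsIrrepOfHighestWeight.sqLength_le`), so `u = 0`, a contradiction.

Hence `φ v = 0`. The kernel of `φ` is stable under 𝔮, which contains the opposite Borel subalgebra,
and `v` generates `E` under the latter (`eq_top_of_lie_mem`); so `φ = 0`. -/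

noncomputable section

/-! ### Lowest weight vectors for 𝔰𝔩₂. -/

namespace IsSl2Triple

variable {L M : Type*} [LieRing L] [LieAlgebra ℂ L] [AddCommGroup M] [Module ℂ M]
  [LieRingModule L M] [LieModule ℂ L M] {h e f : L}

lemma lie_h_pow_toEnd_f (t : IsSl2Triple h e f) {m : M} {c : ℂ} (hm : ⁅h, m⁆ = c • m) (n : ℕ) :
    ⁅h, (toEnd ℂ L M f ^ n) m⁆ = (c - 2 * n) • (toEnd ℂ L M f ^ n) m := by
  have := t.symm.lie_h_pow_toEnd_e (R := ℂ) (μ := -c) (m := m) (by simp [hm]) n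
  rw [neg_lie, neg_eq_iff_eq_neg, ← neg_smul] at this
  rw [this]
  congr 1
  ring

/-- Applying the lowering operator often enough to an eigenvector of `h` in a finite-dimensional
representation gives a lowest weight vector. -/
lemma exists_lowest_pow_toEnd_f [FiniteDimensional ℂ M] (t : IsSl2Triple h e f) {m : M} {c : ℂ}
    (hm₀ : m ≠ 0) (hm : ⁅h, m⁆ = c • m) :
    ∃ j N : ℕ, t.symm.HasPrimitiveVectorWith ((toEnd ℂ L M f ^ j) m) (N : ℂ) ∧
      c = 2 * j - N := by
  obtain ⟨n, hn⟩ : ∃ n : ℕ, (toEnd ℂ L M f ^ n) m = 0 := by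
    -- Otherwise the numbers `c - 2 * n` would be infinitely many eigenvalues of `h`.
    by_contra! contra
    have hs : (Set.range fun n : ℕ ↦ c - 2 * n).Infinite := by
      rw [Set.infinite_range_iff (fun n m ↦ by simp)]; infer_instance
    refine hs ((toEnd ℂ L M h).finite_hasEigenvalue.subset ?_)
    rintro - ⟨n, rfl⟩
    exact Module.End.hasEigenvalue_of_hasEigenvector (x := (toEnd ℂ L M f ^ n) m)
      ⟨Module.End.mem_eigenspace_iff.mpr (t.lie_h_pow_toEnd_f hm n), contra n⟩
  obtain ⟨j, hj, hj'⟩ := Nat.exists_not_and_succ_of_not_zero_of_exists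
    (p := fun n ↦ (toEnd ℂ L M f ^ n) m = 0) (by simpa using hm₀) ⟨n, hn⟩
  have P : t.symm.HasPrimitiveVectorWith ((toEnd ℂ L M f ^ j) m) (2 * j - c) :=
    { ne_zero := hj
      lie_h := by rw [neg_lie, t.lie_h_pow_toEnd_f hm, ← neg_smul, neg_sub]
      lie_e := by simpa [pow_succ'] using hj' }
  obtain ⟨N, hN⟩ := P.exists_nat
  exact ⟨j, N, hN ▸ P, by rw [← hN]; ring⟩

end IsSl2Triple

/-! ### Root strings, root lengths and positive systems. -/

namespace ParabolicHom

variable {L : Type*} [LieRing L] [LieAlgebra ℂ L] [FiniteDimensional ℂ L] [IsKilling ℂ L]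
  {H : LieSubalgebra ℂ L} [H.IsCartanSubalgebra]

lemma mem_roots_iff {α : Module.Dual ℂ H} :
    α ∈ roots H ↔ ∃ w : Weight ℂ H L, w.IsNonZero ∧ w.toLinear = α := by
  constructor
  · rintro ⟨i, rfl⟩
    exact ⟨i, H.isNonZero_coe_root i, rfl⟩
  · rintro ⟨w, hw, rfl⟩
    exact ⟨⟨w, by simpa [LieSubalgebra.root] using hw⟩, rfl⟩

lemma exists_ne_zero_of_mem_roots {α : Module.Dual ℂ H} (hα : α ∈ roots H) :
    ∃ x ∈ rootSpace H (α : H → ℂ), x ≠ 0 := by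
  obtain ⟨w, -, rfl⟩ := mem_roots_iff.mp hα
  exact w.exists_ne_zero

lemma neg_mem_roots {α : Module.Dual ℂ H} (hα : α ∈ roots H) : -α ∈ roots H := by
  obtain ⟨w, hw, rfl⟩ := mem_roots_iff.mp hα
  exact mem_roots_iff.mpr ⟨-w, hw.neg, by simp⟩

lemma exists_smul_eq_of_mem_rootSpace {α : Module.Dual ℂ H} (hα : α ∈ roots H) {x y : L}
    (hx : x ∈ rootSpace H (α : H → ℂ)) (hx₀ : x ≠ 0) (hy : y ∈ rootSpace H (α : H → ℂ)) :
    ∃ c : ℂ, c • x = y := by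
  obtain ⟨w, hw, rfl⟩ := mem_roots_iff.mp hα
  obtain ⟨c, hc⟩ := (finrank_eq_one_iff_of_nonzero' (⟨x, hx⟩ : rootSpace H w)
    (fun h ↦ hx₀ (congrArg Subtype.val h))).mp (finrank_rootSpace_eq_one w hw) ⟨y, hy⟩
  exact ⟨c, congrArg Subtype.val hc⟩

/-- If `α`, `β` and `α - β` are roots, then bracketing with the root space of `-β` does not
annihilate the root space of `α`. -/
lemma exists_lie_ne_zero {α β : Module.Dual ℂ H} (hα : α ∈ roots H) (hβ : β ∈ roots H)
    (hαβ : α - β ∈ roots H) {y : L} (hy : y ∈ rootSpace H (α : H → ℂ)) (hy₀ : y ≠ 0) :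
    ∃ f ∈ rootSpace H ((-β : Module.Dual ℂ H) : H → ℂ), ⁅f, y⁆ ≠ 0 := by
  obtain ⟨w, hw, rfl⟩ := mem_roots_iff.mp hβ
  obtain ⟨h, e, f, t, he, hf⟩ := exists_isSl2Triple_of_weight_isNonZero hw
  have hh : h = coroot w := t.h_eq_coroot hw he hf
  have hw2 : w (coroot w) = 2 := root_apply_coroot hw
  have hact {μ : Module.Dual ℂ H} {x : L} (hx : x ∈ rootSpace H (μ : H → ℂ)) :
      ⁅h, x⁆ = μ (coroot w) • x := by
    rw [hh]; exact lie_eq_smul_of_mem_rootSpace hx (coroot w)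
  -- If `f` kills `y`, then `y` is a lowest weight vector, of `h`-eigenvalue `-n`. Lower a nonzero
  -- `z` of weight `α - β` to a lowest weight vector `f ^ j z`, of eigenvalue `-N`. Since root
  -- spaces are lines, `e ^ (j + 1)` takes it to a multiple of `y`, which `f` kills. But `f` must
  -- give, up to sign, `(j + 1) * (N - j)` times `e ^ j (f ^ j z) ≠ 0`, and `N - j = j + 2 + n > 0`.
  refine ⟨f, hf, fun hfy ↦ ?_⟩
  obtain ⟨z, hz, hz₀⟩ := exists_ne_zero_of_mem_roots hαβ
  obtain ⟨n, hn⟩ := IsSl2Triple.HasPrimitiveVectorWith.exists_nat (t := t.symm) (R := ℂ)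
    (⟨hy₀, by rw [neg_lie, hact hy, ← neg_smul], hfy⟩ :
      t.symm.HasPrimitiveVectorWith y (-α (coroot w)))
  obtain ⟨j, N, P, hN⟩ := t.exists_lowest_pow_toEnd_f hz₀ (hact hz)
  have hNn : N = 2 * j + 2 + n := by
    have h1 : (α - w.toLinear) (coroot w) = α (coroot w) - 2 := by
      rw [LinearMap.sub_apply, Weight.toLinear_apply, hw2]
    rw [h1] at hN
    have : (N : ℂ) = ((2 * j + 2 + n : ℕ) : ℂ) := by
      push_cast
      linear_combination hN + hn
    exact_mod_cast this
  have hmem : (toEnd ℂ L L e ^ (j + 1)) ((toEnd ℂ L L f ^ j) z) ∈ rootSpace H (α : H → ℂ) := by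
    convert! toEnd_pow_apply_mem he (toEnd_pow_apply_mem hf hz j) (j + 1) using 2
    ext x
    simp
    ring
  obtain ⟨c, hc⟩ := exists_smul_eq_of_mem_rootSpace hα hy hy₀ hmem
  have key := P.lie_e_pow_succ_toEnd_f j
  rw [← hc, lie_smul, hfy, smul_zero, eq_comm, smul_eq_zero] at key
  refine key.elim (fun h0 ↦ ?_) (P.pow_toEnd_f_ne_zero_of_eq_nat rfl (by lia))
  rw [hNn] at h0
  have : ((j + 1 : ℕ) : ℂ) * ((j + 2 + n : ℕ) : ℂ) = 0 := by
    push_cast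
    push_cast at h0
    linear_combination h0
  rw [← Nat.cast_mul, Nat.cast_eq_zero] at this
  simp at this

lemma dualForm_eq_apply (μ ν : Module.Dual ℂ H) :
    dualForm H μ ν = μ ((cartanEquivDual H).symm ν) := by
  have := LinearMap.congr_fun ((cartanEquivDual H).apply_symm_apply μ) ((cartanEquivDual H).symm ν)
  rw [← this]
  rfl

lemma dualForm_comm (μ ν : Module.Dual ℂ H) : dualForm H μ ν = dualForm H ν μ :=
  LieModule.traceForm_comm ℂ L L _ _

lemma realForm_comm (μ ν : Module.Dual ℂ H) : realForm H μ ν = realForm H ν μ := by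
  rw [realForm, dualForm_comm, realForm]

lemma realForm_neg (lam μ : Module.Dual ℂ H) : realForm H lam (-μ) = -realForm H lam μ := by
  simp [realForm, dualForm]

lemma realForm_sub (lam μ ν : Module.Dual ℂ H) :
    realForm H lam (μ - ν) = realForm H lam μ - realForm H lam ν := by
  rw [sub_eq_add_neg, realForm_add, realForm_neg, sub_eq_add_neg]

lemma sqLength_add_natCast_smul (μ α : Module.Dual ℂ H) (k : ℕ) :
    sqLength H (μ + k • α) = sqLength H μ + 2 * k * realForm H μ α + k ^ 2 * sqLength H α := by
  have h : dualForm H (μ + k • α) (μ + k • α) =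
      dualForm H μ μ + (2 * k : ℝ) * dualForm H μ α + (k ^ 2 : ℝ) * dualForm H α α := by
    have h1 := dualForm_comm α μ
    rw [dualForm_eq_apply, dualForm_eq_apply] at h1
    simp only [dualForm_eq_apply, map_add, map_nsmul, LinearMap.add_apply, LinearMap.smul_apply,
      h1, nsmul_eq_mul]
    push_cast
    ring
  rw [sqLength, realForm, h]
  simp only [Complex.add_re, Complex.re_ofReal_mul, sqLength, realForm]

/-- The squared length of a root is a positive real number. -/
lemma exists_pos_dualForm_eq {α : Module.Dual ℂ H} (hα : α ∈ roots H) :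
    ∃ r : ℝ, 0 < r ∧ dualForm H α α = r := by
  obtain ⟨w, hw, rfl⟩ := mem_roots_iff.mp hα
  have hne : w ((cartanEquivDual H).symm w) ≠ 0 := root_apply_cartanEquivDual_symm_ne_zero hw
  -- The Killing norm of the coroot is both a sum of squares of integers and `4 / ⟨α, α⟩`. The root
  -- itself contributes `2 ^ 2` to the sum, which is therefore positive.
  have h1 : killingForm ℂ L (coroot w) (coroot w) = ∑ β ∈ H.root, (β (coroot w)) ^ 2 := by
    have := LinearMap.congr_fun₂ (restrict_killingForm_eq_sum (K := ℂ) (H := H))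
      (coroot w) (coroot w)
    simp only [LinearMap.sum_apply, LinearMap.smulRight_apply, LinearMap.smul_apply,
      smul_eq_mul] at this
    simp only [sq]
    exact this
  have h2 : killingForm ℂ L (coroot w) (coroot w) = 4 / dualForm H w.toLinear w.toLinear := by
    rw [dualForm_eq_apply]
    have := traceForm_coroot w (coroot w)
    rw [root_apply_coroot hw] at this
    refine Eq.trans this ?_
    simp only [Weight.toLinear_apply, nsmul_eq_mul, smul_eq_mul]
    field_simp
    norm_num
  have h3 : ∑ β ∈ H.root, (β (coroot w)) ^ 2 =
      ((∑ β ∈ H.root, ((chainBotCoeff w β - chainTopCoeff w β : ℤ) : ℝ) ^ 2 : ℝ) : ℂ) := by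
    push_cast
    refine Finset.sum_congr rfl fun β _ ↦ ?_
    rw [apply_coroot_eq_cast]
    push_cast
    rfl
  have hpos : 0 < ∑ β ∈ H.root, ((chainBotCoeff w β - chainTopCoeff w β : ℤ) : ℝ) ^ 2 := by
    refine Finset.sum_pos' (fun _ _ ↦ sq_nonneg _) ⟨w, by simpa [LieSubalgebra.root] using hw, ?_⟩
    have : ((chainBotCoeff w w - chainTopCoeff w w : ℤ) : ℂ) = 2 := by
      rw [← root_apply_coroot hw, apply_coroot_eq_cast]
    rw [show (chainBotCoeff w w - chainTopCoeff w w : ℤ) = 2 by exact_mod_cast this]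
    norm_num
  refine ⟨_, div_pos (zero_lt_four) hpos, ?_⟩
  rw [Complex.ofReal_div, ← h3, ← h1, h2]
  push_cast
  have : dualForm H w.toLinear w.toLinear ≠ 0 := by rw [dualForm_eq_apply]; exact hne
  field_simp

lemma two_mul_dualForm_eq {w : Weight ℂ H L} (hw : w.IsNonZero) (μ : Module.Dual ℂ H) :
    2 * dualForm H μ w.toLinear = μ (coroot w) * dualForm H w.toLinear w.toLinear := by
  have hne : w ((cartanEquivDual H).symm w) ≠ 0 := root_apply_cartanEquivDual_symm_ne_zero hw
  simp only [dualForm_eq_apply, coroot, map_nsmul, map_smul, smul_eq_mul, nsmul_eq_mul,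
    Weight.toLinear_apply]
  push_cast
  field_simp

/-- The height, extended linearly to the whole dual of 𝔥 so that it also applies to weights of `E`.
-/
lemma exists_height (b : (rootSystem H).Base) :
    ∃ F : Module.Dual ℂ H →ₗ[ℂ] ℂ, ∀ α ∈ posRoots b, 0 < (F α).re := by
  refine ⟨b.toWeightBasis.constr ℂ fun _ ↦ (1 : ℂ), ?_⟩
  rintro - ⟨i, hi, rfl⟩
  obtain ⟨f, -, -, hf⟩ := b.exists_root_eq_sum_int i
  have hi' : 0 < ∑ j ∈ b.support, f j := by
    rw [← RootPairing.Base.height_eq_sum hf]; exact hi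
  have : (b.toWeightBasis.constr ℂ fun _ ↦ (1 : ℂ)) ((rootSystem H).root i) =
      ((∑ j ∈ b.support, f j : ℤ) : ℂ) := by
    rw [hf, map_sum, Int.cast_sum]
    refine Finset.sum_congr rfl fun j hj ↦ ?_
    have h1 := b.toWeightBasis.constr_basis ℂ (fun _ ↦ (1 : ℂ)) ⟨j, hj⟩
    rw [RootPairing.Base.toWeightBasis_apply] at h1
    rw [map_zsmul, h1]
    simp
  rw [this, Complex.intCast_re]
  exact_mod_cast hi'

lemma posRoots_subset_roots (b : (rootSystem H).Base) : posRoots b ⊆ roots H :=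
  Set.image_subset_range _ _

lemma mem_posRoots_or_neg_mem (b : (rootSystem H).Base) {α : Module.Dual ℂ H}
    (hα : α ∈ roots H) : α ∈ posRoots b ∨ -α ∈ posRoots b := by
  obtain ⟨i, rfl⟩ := hα
  let := (rootSystem H).indexNeg
  rcases lt_or_gt_of_ne (b.height_ne_zero i) with h | h
  · refine .inr ⟨-i, ?_, by simp [-rootSystem_root_apply]⟩
    change 0 < b.height (-i)
    rw [b.height_reflectionPerm_self]
    lia
  · exact .inl ⟨i, h, rfl⟩

end ParabolicHom
end

/-! ### Weights of highest weight representations. -/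

noncomputable section

namespace ParabolicHom

lemma mem_of_isZero {L : Type*} [LieRing L] [LieAlgebra ℂ L] [FiniteDimensional ℂ L]
    {H : LieSubalgebra ℂ L} [H.IsCartanSubalgebra] {w : Weight ℂ H L} (hw : w.IsZero) {x : L}
    (hx : x ∈ rootSpace H w) : x ∈ H := by
  rw [hw] at hx
  rwa [rootSpace_zero_eq ℂ L H, LieSubalgebra.mem_toLieSubmodule] at hx

variable {L : Type*} [LieRing L] [LieAlgebra ℂ L] [FiniteDimensional ℂ L] [IsKilling ℂ L]
  {H : LieSubalgebra ℂ L} [H.IsCartanSubalgebra]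
  {E : Type*} [AddCommGroup E] [Module ℂ E] [LieRingModule L E] [LieModule ℂ L E]

/-- In an irreducible representation generated by a vector `v` annihilated by the positive root
spaces, a subspace that contains `v` and is stable under the opposite Borel subalgebra is
everything. -/
lemma eq_top_of_lie_mem [LieModule.IsIrreducible ℂ L E] {b : (rootSystem H).Base}
    {γ : Module.Dual ℂ H} {v : E} (hv₀ : v ≠ 0) (hv : ∀ h : H, ⁅(h : L), v⁆ = γ h • v)
    (hv' : ∀ α ∈ posRoots b, ∀ x ∈ rootSpace H (α : H → ℂ), ⁅x, v⁆ = 0)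
    {K : Submodule ℂ E} (hvK : v ∈ K) (hKH : ∀ h : H, ∀ u ∈ K, ⁅(h : L), u⁆ ∈ K)
    (hK : ∀ α ∈ posRoots b, ∀ x ∈ rootSpace H ((-α : Module.Dual ℂ H) : H → ℂ), ∀ u ∈ K,
      ⁅x, u⁆ ∈ K) :
    K = ⊤ := by
  let B : Set L := {x | x ∈ H ∨ ∃ α ∈ posRoots b, x ∈ rootSpace H ((-α : Module.Dual ℂ H) : H → ℂ)}
  let C : Set (Submodule ℂ E) := {S | v ∈ S ∧ ∀ y ∈ B, ∀ u ∈ S, ⁅y, u⁆ ∈ S}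
  let S : Submodule ℂ E := sInf C
  have hvS : v ∈ S := Submodule.mem_sInf.mpr fun T hT ↦ hT.1
  have hBS : ∀ y ∈ B, ∀ u ∈ S, ⁅y, u⁆ ∈ S := fun y hy u hu ↦
    Submodule.mem_sInf.mpr fun T hT ↦ hT.2 y hy u (Submodule.mem_sInf.mp hu T hT)
  have hxv : ∀ x : L, ⁅x, v⁆ ∈ S := by
    intro x
    have hx : x ∈ ⨆ w : Weight ℂ H L, rootSpace H w := by
      rw [iSup_genWeightSpace_eq_top' ℂ H L]; trivial
    induction hx using LieSubmodule.iSup_induction' with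
    | zero => simp
    | add x y _ _ hx hy => rw [add_lie]; exact add_mem hx hy
    | mem w x hx =>
      by_cases hw : w.IsZero
      · have := hv ⟨x, mem_of_isZero hw hx⟩
        rw [this]
        exact S.smul_mem _ hvS
      · rcases mem_posRoots_or_neg_mem b (mem_roots_iff.mpr ⟨w, hw, rfl⟩) with h | h
        · rw [hv' _ h x hx]
          exact S.zero_mem
        · exact hBS x (.inr ⟨_, h, by rwa [neg_neg]⟩) v hvS
  -- `S` is the smallest subspace that contains `v` and is stable under the opposite Borel. The part
  -- of `S` that all of 𝔤 maps into `S` has both properties too, by the Leibniz rule, so it equals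
  -- `S`. Thus `S` is a 𝔤-submodule.
  let S' : Submodule ℂ E :=
    { carrier := {u | u ∈ S ∧ ∀ x : L, ⁅x, u⁆ ∈ S}
      zero_mem' := ⟨S.zero_mem, fun x ↦ by simp⟩
      add_mem' := fun ha hb ↦ ⟨add_mem ha.1 hb.1, fun x ↦ by
        rw [lie_add]; exact add_mem (ha.2 x) (hb.2 x)⟩
      smul_mem' := fun c a ha ↦ ⟨S.smul_mem c ha.1, fun x ↦ by
        rw [lie_smul]; exact S.smul_mem c (ha.2 x)⟩ }
  have hSS' : S ≤ S' := sInf_le ⟨⟨hvS, hxv⟩, fun y hy u hu ↦ ⟨hBS y hy u hu.1, fun x ↦ by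
    rw [leibniz_lie]
    exact add_mem (hu.2 _) (hBS y hy _ (hu.2 x))⟩⟩
  let N : LieSubmodule ℂ L E := { S with lie_mem := fun {x u} hu ↦ (hSS' hu).2 x }
  have hN : N = ⊤ := by
    refine (eq_bot_or_eq_top N).resolve_left fun h ↦ hv₀ ?_
    have : v ∈ N := hvS
    rwa [h, LieSubmodule.mem_bot] at this
  have hS : S = ⊤ := congrArg LieSubmodule.toSubmodule hN
  rw [eq_top_iff, ← hS]
  refine sInf_le ⟨hvK, ?_⟩
  rintro y (hy | ⟨α, hα, hy⟩) u hu
  · exact hKH ⟨y, hy⟩ u hu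
  · exact hK α hα y hy u hu

lemma lie_mem_weightSpace {α μ : Module.Dual ℂ H} {x : L} {u : E}
    (hx : x ∈ rootSpace H (α : H → ℂ)) (hu : u ∈ weightSpace E (μ : H → ℂ)) :
    ⁅x, u⁆ ∈ weightSpace E ((α + μ : Module.Dual ℂ H) : H → ℂ) := by
  rw [mem_weightSpace] at hu ⊢
  intro h
  have h1 : ⁅(h : L), u⁆ = μ h • u := hu h
  have h2 : ⁅(h : L), x⁆ = α h • x := lie_eq_smul_of_mem_rootSpace hx h
  change ⁅(h : L), ⁅x, u⁆⁆ = _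
  rw [leibniz_lie, h1, h2, smul_lie, lie_smul, LinearMap.add_apply, add_smul]

lemma pow_toEnd_mem_weightSpace {α μ : Module.Dual ℂ H} {x : L} {u : E}
    (hx : x ∈ rootSpace H (α : H → ℂ)) (hu : u ∈ weightSpace E (μ : H → ℂ)) (n : ℕ) :
    (toEnd ℂ L E x ^ n) u ∈ weightSpace E ((n • α + μ : Module.Dual ℂ H) : H → ℂ) := by
  induction n with
  | zero => simpa using hu
  | succ n ih =>
    rw [pow_succ', succ_nsmul', add_assoc]
    exact lie_mem_weightSpace hx ih

/-- The weights of a highest weight representation differ from the highest weight by sums of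
positive roots. -/
lemma IsIrrepOfHighestWeight.sub_mem_closure {b : (rootSystem H).Base} {γ : Module.Dual ℂ H}
    (hE : IsIrrepOfHighestWeight b γ E) {μ : Module.Dual ℂ H} {u : E} (hu₀ : u ≠ 0)
    (hu : u ∈ weightSpace E (μ : H → ℂ)) :
    γ - μ ∈ AddSubmonoid.closure (posRoots b) := by
  have := hE.finiteDimensional
  have := hE.irreducible
  obtain ⟨v, hv₀, hv, hv'⟩ := hE.exists_highestWeightVector
  let P := AddSubmonoid.closure (posRoots b)
  let K : Submodule ℂ E :=
    ⨆ ν : P, (weightSpace E ((γ - ν : Module.Dual ℂ H) : H → ℂ)).toSubmodule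
  have hK (x : L) (α : Module.Dual ℂ H) (hα : -α ∈ P) (hx : x ∈ rootSpace H (α : H → ℂ)) (w : E)
      (hw : w ∈ K) : ⁅x, w⁆ ∈ K := by
    induction hw using Submodule.iSup_induction' with
    | zero => simp
    | add a b _ _ ha hb => rw [lie_add]; exact add_mem ha hb
    | mem ν a ha =>
      refine Submodule.mem_iSup_of_mem ⟨_, P.add_mem hα ν.2⟩ ?_
      have := lie_mem_weightSpace hx ha
      rwa [show α + (γ - ν) = γ - (-α + ν) by abel] at this
  have hKtop : K = ⊤ := by
    refine eq_top_of_lie_mem hv₀ hv hv' ?_ (fun h u hu ↦ ?_) (fun α hα x hx u hu ↦ ?_)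
    · refine Submodule.mem_iSup_of_mem ⟨0, P.zero_mem⟩ ?_
      change v ∈ weightSpace E _
      rw [mem_weightSpace]
      intro h
      simpa using hv h
    · refine hK h 0 (by rw [neg_zero]; exact P.zero_mem) ?_ u hu
      change (h : L) ∈ rootSpace H (0 : H → ℂ)
      rw [rootSpace_zero_eq ℂ L H, LieSubalgebra.mem_toLieSubmodule]
      exact h.2
    · exact hK x (-α) (by rw [neg_neg]; exact AddSubmonoid.subset_closure hα) hx u hu
  -- A weight outside `γ - P` would have its weight space independent of the sum `K`, which is
  -- everything.
  by_contra hμ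
  have hind := LieSubmodule.iSupIndep_toSubmodule.mpr (iSupIndep_genWeightSpace ℂ H E)
  have hle : K ≤ ⨆ (χ : H → ℂ) (_ : χ ≠ μ), (genWeightSpace E χ).toSubmodule := by
    refine iSup_le fun ν ↦ ?_
    refine le_trans ?_ (le_iSup₂_of_le ((γ - ν : Module.Dual ℂ H) : H → ℂ) ?_ le_rfl)
    · exact weightSpace_le_genWeightSpace E _
    · intro h
      apply hμ
      rw [← DFunLike.coe_injective h, sub_sub_cancel]
      exact ν.2
  refine hu₀ (Submodule.disjoint_def.mp (hind μ) u (weightSpace_le_genWeightSpace E _ hu) ?_)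
  exact hle (hKtop ▸ Submodule.mem_top)

/-- If the weight `μ` pairs negatively with a positive root, then there is a weight of at least the
same length that is higher than `μ`. -/
lemma exists_higher_weight [FiniteDimensional ℂ E] {μ α : Module.Dual ℂ H} (hα : α ∈ roots H)
    {u : E} (hu₀ : u ≠ 0) (hu : u ∈ weightSpace E (μ : H → ℂ)) (hμα : realForm H μ α < 0) :
    ∃ k : ℕ, 0 < k ∧ sqLength H μ ≤ sqLength H (μ + k • α) ∧
      ∃ u' : E, u' ≠ 0 ∧ u' ∈ weightSpace E ((μ + k • α : Module.Dual ℂ H) : H → ℂ) := by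
  obtain ⟨r, hr, hαr⟩ := exists_pos_dualForm_eq hα
  obtain ⟨w, hw, rfl⟩ := mem_roots_iff.mp hα
  obtain ⟨h, e, f, t, he, hf⟩ := exists_isSl2Triple_of_weight_isNonZero hw
  have hh : h = coroot w := t.h_eq_coroot hw he hf
  have hact : ⁅h, u⁆ = μ (coroot w) • u := by
    rw [hh]; exact (mem_weightSpace _ _).mp hu (coroot w)
  obtain ⟨j, N, P, hN⟩ := t.exists_lowest_pow_toEnd_f hu₀ hact
  have hre : 2 * realForm H μ w.toLinear = (2 * j - N) * r := by
    have := two_mul_dualForm_eq hw μ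
    rw [hN, hαr] at this
    have h2 : 2 * dualForm H μ w.toLinear = (((2 * j - N) * r : ℝ) : ℂ) := by
      rw [this]; push_cast; rfl
    have h3 := congrArg Complex.re h2
    rw [Complex.ofReal_re] at h3
    rw [← h3, realForm]
    simp
  have hsq : sqLength H w.toLinear = r := by
    rw [sqLength, realForm, hαr, Complex.ofReal_re]
  have hjN : 2 * j < N := by
    have : (2 * j - N : ℝ) < 0 := by
      by_contra! h0
      nlinarith [mul_nonneg h0 hr.le]
    exact_mod_cast (sub_neg.mp this)
  -- `μ + k • α` is the top of the 𝔰𝔩₂-string through `f ^ j u`, reached by `e ^ N`. As `2⟨μ, α⟩ =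
  -- (j - k) r`, the squared length changes by `k (j - k) r + k² r = k j r ≥ 0`.
  obtain ⟨k, rfl⟩ : ∃ k, N = j + k := ⟨N - j, by lia⟩
  refine ⟨k, by lia, ?_, (toEnd ℂ L E e ^ (j + k)) ((toEnd ℂ L E f ^ j) u), ?_, ?_⟩
  · rw [sqLength_add_natCast_smul, hsq]
    push_cast at hre
    have : (0 : ℝ) ≤ k * j * r := by positivity
    have h4 : (2 * k * realForm H μ w.toLinear : ℝ) = k * ((2 * j - (j + k)) * r) := by
      rw [← hre]; ring
    rw [h4]
    linarith
  · exact P.pow_toEnd_f_ne_zero_of_eq_nat rfl le_rfl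
  · have hf' : f ∈ rootSpace H ((-w.toLinear : Module.Dual ℂ H) : H → ℂ) := hf
    have := pow_toEnd_mem_weightSpace (α := w.toLinear) he
      (pow_toEnd_mem_weightSpace hf' hu j) (j + k)
    rwa [show (j + k) • w.toLinear + (j • -w.toLinear + μ) = μ + k • w.toLinear by
      rw [add_smul, smul_neg]; abel] at this

/-- No weight of an irreducible representation is longer than its dominant highest weight. -/
lemma IsIrrepOfHighestWeight.sqLength_le {b : (rootSystem H).Base} {γ : Module.Dual ℂ H}
    (hE : IsIrrepOfHighestWeight b γ E) (hγ : IsDominant b γ) {μ : Module.Dual ℂ H} {u : E}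
    (hu₀ : u ≠ 0) (hu : u ∈ weightSpace E (μ : H → ℂ)) :
    sqLength H μ ≤ sqLength H γ := by
  have := hE.finiteDimensional
  obtain ⟨F, hF⟩ := exists_height b
  by_contra! hlt
  let T : Set (Module.Dual ℂ H) :=
    {μ | sqLength H γ < sqLength H μ ∧ ∃ u : E, u ≠ 0 ∧ u ∈ weightSpace E (μ : H → ℂ)}
  have hT : T.Finite := by
    refine Set.Finite.of_finite_image (f := fun μ : Module.Dual ℂ H ↦ (μ : H → ℂ))
      ((finite_genWeightSpace_ne_bot ℂ H E).subset ?_) DFunLike.coe_injective.injOn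
    rintro - ⟨ν, ⟨-, u, hu₀, hu⟩, rfl⟩ hbot
    have := weightSpace_le_genWeightSpace E _ hu
    rw [hbot, LieSubmodule.mem_bot] at this
    exact hu₀ this
  -- Among the weights longer than `γ`, one of greatest height must be dominant. Since `γ - μ` is a
  -- sum of positive roots, it pairs nonnegatively with `γ` and with `μ`, whence `⟨μ, μ⟩ ≤ ⟨γ, μ⟩ ≤
  -- ⟨γ, γ⟩`.
  obtain ⟨μ, ⟨hμ, u, hu₀, hu⟩, hmax⟩ := T.exists_max_image (fun μ ↦ (F μ).re) hT
    ⟨μ, hlt, u, hu₀, hu⟩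
  have hdom : IsDominant b μ := by
    intro α hα
    by_contra! hneg
    obtain ⟨k, hk, hle, u', hu'₀, hu'⟩ :=
      exists_higher_weight (posRoots_subset_roots b hα) hu₀ hu hneg
    have := hmax (μ + k • α) ⟨hμ.trans_le hle, u', hu'₀, hu'⟩
    rw [map_add, map_nsmul, Complex.add_re, Complex.smul_re, nsmul_eq_mul] at this
    have h1 : 0 < (k : ℝ) * (F α).re := mul_pos (by exact_mod_cast hk) (hF α hα)
    linarith
  have hnn {ν : Module.Dual ℂ H} (hν : IsDominant b ν) : 0 ≤ realForm H ν (γ - μ) := by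
    refine AddSubmonoid.closure_induction (motive := fun x _ ↦ 0 ≤ realForm H ν x) hν
      (realForm_zero H ν).ge (fun x y _ _ hx hy ↦ ?_) (hE.sub_mem_closure hu₀ hu)
    rw [realForm_add]
    exact add_nonneg hx hy
  have h1 := hnn hγ
  have h2 := hnn hdom
  rw [realForm_sub] at h1 h2
  rw [realForm_comm γ μ] at h1
  rw [sqLength, sqLength] at hμ
  linarith

end ParabolicHom
end

/-! ### Equivariant maps to 𝔤/𝔮. -/

noncomputable section

namespace ParabolicHom

variable {L : Type*} [LieRing L] [LieAlgebra ℂ L] [FiniteDimensional ℂ L] [IsKilling ℂ L]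
  {H : LieSubalgebra ℂ L} [H.IsCartanSubalgebra]
  {E : Type*} [AddCommGroup E] [Module ℂ E] [LieRingModule L E] [LieModule ℂ L E]

variable (H) in
/-- The nilradical `𝔲` of the parabolic subalgebra opposite to `𝔮(lam)`. -/
def oppNilradical (lam : Module.Dual ℂ H) : LieSubmodule ℂ H L :=
  ⨆ α : oppNilRoots H lam, rootSpace H (α.1 : H → ℂ)

lemma rootSpace_le_oppNilradical {lam α : Module.Dual ℂ H} (hα : α ∈ oppNilRoots H lam) :
    rootSpace H (α : H → ℂ) ≤ oppNilradical H lam :=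
  le_iSup (fun α : oppNilRoots H lam ↦ rootSpace H (α.1 : H → ℂ)) ⟨α, hα⟩

lemma rootSpace_le_parabolic {lam α : Module.Dual ℂ H} (hα : α ∈ parabolicRoots H lam) {x : L}
    (hx : x ∈ rootSpace H (α : H → ℂ)) : x ∈ parabolic H lam :=
  (le_sup_of_le_right (le_iSup₂_of_le α hα le_rfl) :
    (rootSpace H (α : H → ℂ)).toSubmodule ≤ parabolicSubmodule H lam) hx

lemma coe_mem_parabolic (lam : Module.Dual ℂ H) (h : H) : (h : L) ∈ parabolic H lam :=
  (le_sup_left : H.toSubmodule ≤ parabolicSubmodule H lam) h.2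

lemma eq_zero_of_mem_parabolic_of_mem_oppNilradical {lam : Module.Dual ℂ H} {x : L}
    (hq : x ∈ parabolic H lam) (hu : x ∈ oppNilradical H lam) : x = 0 := by
  have hind := LieSubmodule.iSupIndep_toSubmodule.mpr (iSupIndep_genWeightSpace ℂ H L)
  have hdisj := hind.disjoint_biSup_biSup
    (s := {χ | ∃ μ : Module.Dual ℂ H, realForm H lam μ ≤ 0 ∧ (μ : H → ℂ) = χ})
    (t := {χ | ∃ μ : Module.Dual ℂ H, 0 < realForm H lam μ ∧ (μ : H → ℂ) = χ}) (by
      rw [Set.disjoint_left]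
      rintro - ⟨μ, hμ, rfl⟩ ⟨ν, hν, h⟩
      rw [DFunLike.coe_injective h] at hν
      linarith)
  refine Submodule.disjoint_def.mp hdisj x ?_ ?_
  · replace hq : x ∈ parabolicSubmodule H lam := hq
    rw [parabolicSubmodule_eq] at hq
    refine SetLike.le_def.mp (iSup_le fun μ ↦ ?_) hq
    exact le_iSup₂_of_le (μ.1 : H → ℂ) ⟨μ.1, μ.2, rfl⟩ le_rfl
  · rw [← LieSubmodule.mem_toSubmodule, oppNilradical, LieSubmodule.iSup_toSubmodule] at hu
    refine SetLike.le_def.mp (iSup_le fun μ ↦ ?_) hu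
    exact le_iSup₂_of_le (μ.1 : H → ℂ) ⟨μ.1, μ.2.2, rfl⟩ le_rfl

lemma exists_sub_mem_parabolic (lam : Module.Dual ℂ H) (x : L) :
    ∃ y ∈ oppNilradical H lam, x - y ∈ parabolic H lam := by
  have hx : x ∈ ⨆ w : Weight ℂ H L, rootSpace H w := by
    rw [iSup_genWeightSpace_eq_top' ℂ H L]; trivial
  induction hx using LieSubmodule.iSup_induction' with
  | zero => exact ⟨0, zero_mem _, by simp⟩
  | add a b _ _ ha hb =>
    obtain ⟨y, hy, hay⟩ := ha
    obtain ⟨z, hz, hbz⟩ := hb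
    exact ⟨y + z, add_mem hy hz, by rw [add_sub_add_comm]; exact add_mem hay hbz⟩
  | mem w a ha =>
    by_cases hw : w.IsZero
    · exact ⟨0, zero_mem _, by rw [sub_zero]; exact coe_mem_parabolic lam ⟨a, mem_of_isZero hw ha⟩⟩
    · have hroot : w.toLinear ∈ roots H := mem_roots_iff.mpr ⟨w, hw, rfl⟩
      by_cases hlam : realForm H lam w.toLinear ≤ 0
      · refine ⟨0, zero_mem _, ?_⟩
        rw [sub_zero]
        exact rootSpace_le_parabolic ⟨hroot, hlam⟩ ha
      · refine ⟨a, rootSpace_le_oppNilradical ⟨hroot, not_le.mp hlam⟩ ha, ?_⟩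
        rw [sub_self]
        exact zero_mem _

/-- This puts the opposite Borel subalgebra inside 𝔮: a root and its negative cannot both have
positive height. -/
lemma neg_mem_parabolicRoots {b : (rootSystem H).Base} {lam : Module.Dual ℂ H}
    (hpos : oppNilRoots H lam ⊆ posRoots b) {α : Module.Dual ℂ H} (hα : α ∈ posRoots b) :
    -α ∈ parabolicRoots H lam := by
  refine ⟨neg_mem_roots (posRoots_subset_roots b hα), ?_⟩
  by_contra! h
  obtain ⟨F, hF⟩ := exists_height b
  have h1 := hF _ (hpos ⟨neg_mem_roots (posRoots_subset_roots b hα), h⟩)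
  have h2 := hF _ hα
  rw [map_neg, Complex.neg_re] at h1
  linarith

lemma mk_eq_mk_iff {lam : Module.Dual ℂ H} {x y : L} :
    (LieSubmodule.Quotient.mk x : L ⧸ (parabolic H lam).toLieSubmodule) =
      LieSubmodule.Quotient.mk y ↔ x - y ∈ parabolic H lam :=
  Submodule.Quotient.eq _

variable {lam : Module.Dual ℂ H}
  (φ : E →ₗ⁅ℂ, parabolic H lam⁆ (L ⧸ (parabolic H lam).toLieSubmodule))

omit [LieModule ℂ L E] in
lemma map_lie_eq_mk {u : E} {x y : L} (hx : φ u = LieSubmodule.Quotient.mk x)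
    (hy : y ∈ parabolic H lam) : φ ⁅y, u⁆ = LieSubmodule.Quotient.mk ⁅y, x⁆ := by
  have := φ.map_lie ⟨y, hy⟩ u
  rw [hx] at this
  exact this

/-- A `𝔮`-equivariant map to `𝔤/𝔮` takes a vector of weight `μ` to the class of an element of
`𝔲` of weight `μ`. -/
lemma exists_rootVector_map_eq_mk {μ : Module.Dual ℂ H} {u : E}
    (hu : u ∈ weightSpace E (μ : H → ℂ)) :
    ∃ x ∈ rootSpace H (μ : H → ℂ), x ∈ oppNilradical H lam ∧ φ u = LieSubmodule.Quotient.mk x := by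
  obtain ⟨x₀, hx₀⟩ := Submodule.Quotient.mk_surjective _ (φ u)
  obtain ⟨x, hx, hxx₀⟩ := exists_sub_mem_parabolic lam x₀
  have hφ : φ u = LieSubmodule.Quotient.mk x := by
    rw [← hx₀]; exact mk_eq_mk_iff.mpr hxx₀
  refine ⟨x, weightSpace_le_genWeightSpace L _ ?_, hx, hφ⟩
  rw [mem_weightSpace]
  intro h
  have h1 := map_lie_eq_mk φ hφ (coe_mem_parabolic lam h)
  have h2 : ⁅(h : L), u⁆ = μ h • u := (mem_weightSpace _ _).mp hu h
  rw [h2, map_smul, hφ] at h1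
  have h3 : ⁅(h : L), x⁆ - μ h • x ∈ parabolic H lam := mk_eq_mk_iff.mp h1.symm
  -- Equivariance gives the weight condition only modulo 𝔮; it is exact because 𝔲 is 𝔥-stable and
  -- meets 𝔮 in zero.
  have h4 : ⁅(h : L), x⁆ - μ h • x ∈ oppNilradical H lam :=
    sub_mem ((oppNilradical H lam).lie_mem (x := h) hx) ((oppNilradical H lam).smul_mem _ hx)
  exact sub_eq_zero.mp (eq_zero_of_mem_parabolic_of_mem_oppNilradical h3 h4)

/-- If the minimal and maximal lengths agreed, all roots would have the same length. -/
lemma sqLength_lt_of_isShortRoot_of_isLongRoot (hlen : HasTwoRootLengths H)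
    {γ δ : Module.Dual ℂ H} (hγ : IsShortRoot H γ) (hδ : IsLongRoot H δ) :
    sqLength H γ < sqLength H δ := by
  obtain ⟨c, d, hcd, hset⟩ := Set.ncard_eq_two.mp hlen
  have hc : c ∈ sqLength H '' roots H := hset ▸ by simp
  have hd : d ∈ sqLength H '' roots H := hset ▸ by simp
  obtain ⟨α, hα, rfl⟩ := hc
  obtain ⟨β, hβ, rfl⟩ := hd
  by_contra! hle
  have h1 := hγ.2 α hα
  have h2 := hδ.2 α hα
  have h3 := hγ.2 β hβ
  have h4 := hδ.2 β hβ
  exact hcd (by linarith)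

/-- Following a descending chain of roots by negative root vectors, a nonzero root vector is taken
to a nonzero root vector, compatibly with a map to `𝔤/𝔮`. -/
lemma exists_ne_zero_of_chain {b : (rootSystem H).Base} (hpos : oppNilRoots H lam ⊆ posRoots b)
    {γ : Module.Dual ℂ H} (hγ : γ ∈ roots H) {m : ℕ} {β : Fin m → Module.Dual ℂ H}
    (hβ : ∀ j, β j ∈ posRoots b) (hroot : ∀ k : Fin m, γ - ∑ j ∈ Finset.Iic k, β j ∈ roots H)
    {v : E} (hv : v ∈ weightSpace E (γ : H → ℂ)) {x : L} (hx : x ∈ rootSpace H (γ : H → ℂ))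
    (hx₀ : x ≠ 0) (hφ : φ v = LieSubmodule.Quotient.mk x) (k : ℕ) (hk : k ≤ m) :
    γ - ∑ j with j.val < k, β j ∈ roots H ∧
    ∃ u ∈ weightSpace E ((γ - ∑ j with j.val < k, β j : Module.Dual ℂ H) : H → ℂ),
    ∃ y ∈ rootSpace H ((γ - ∑ j with j.val < k, β j : Module.Dual ℂ H) : H → ℂ),
      y ≠ 0 ∧ φ u = LieSubmodule.Quotient.mk y := by
  induction k with
  | zero =>
    simp only [not_lt_zero, Finset.filter_false, Finset.sum_empty, sub_zero]
    exact ⟨hγ, v, hv, x, hx, hx₀, hφ⟩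
  | succ k ih =>
    obtain ⟨hk', u, hu, y, hy, hy₀, huy⟩ := ih (by lia)
    let i : Fin m := ⟨k, by lia⟩
    have hsum : ∑ j with j.val < k + 1, β j = ∑ j with j.val < k, β j + β i := by
      rw [add_comm (∑ j with _, β j), ← Finset.sum_insert (by simp [i])]
      congr 1
      ext j
      simp [i, Fin.ext_iff]
      lia
    -- `i` has value `k`, so `Finset.Iic i` consists of the first `k + 1` indices.
    have hIic : ∑ j with j.val < k + 1, β j = ∑ j ∈ Finset.Iic i, β j := by
      congr 1
      ext j
      simp [i, Fin.le_def]
    have hk1 : γ - ∑ j with j.val < k + 1, β j ∈ roots H := hIic ▸ hroot i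
    have heq : γ - ∑ j with j.val < k + 1, β j = -β i + (γ - ∑ j with j.val < k, β j) := by
      rw [hsum]; abel
    obtain ⟨f, hf, hfy⟩ := exists_lie_ne_zero hk' (posRoots_subset_roots b (hβ i))
      (by rwa [sub_eq_neg_add, ← heq]) hy hy₀
    refine ⟨hk1, ⁅f, u⁆, ?_, ⁅f, y⁆, ?_, hfy, map_lie_eq_mk φ huy
      (rootSpace_le_parabolic (neg_mem_parabolicRoots hpos (hβ i)) hf)⟩
    · rw [heq]; exact lie_mem_weightSpace hf hu
    · rw [heq]; exact lie_mem_genWeightSpace_of_mem_genWeightSpace hf hy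

end ParabolicHom
end

/-! ### The vanishing theorem. -/

theorem lemma3p1 {L : Type*} [LieRing L] [LieAlgebra ℂ L] [FiniteDimensional ℂ L]
    [LieAlgebra.IsSimple ℂ L]
    (H : LieSubalgebra ℂ L) [H.IsCartanSubalgebra]
    (hlen : ParabolicHom.HasTwoRootLengths H)
    (b : (LieAlgebra.IsKilling.rootSystem H).Base)
    (lam : Module.Dual ℂ H) (hlam : lam ∈ ParabolicHom.realDual H)
    (hpos : ParabolicHom.oppNilRoots H lam ⊆ ParabolicHom.posRoots b)
    (γ : Module.Dual ℂ H) (hγ : ParabolicHom.IsShortRoot H γ)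
    (hdom : ParabolicHom.IsDominant b γ)
    (m : ℕ) (β : Fin m → Module.Dual ℂ H)
    (hβ : ∀ j, β j ∈ ParabolicHom.posRoots b)
    (hroot : ∀ k : Fin m, γ - ∑ j ∈ Finset.Iic k, β j ∈ ParabolicHom.roots H)
    (hlong : ParabolicHom.IsLongRoot H (γ - ∑ j, β j))
    (hu : γ - ∑ j, β j ∈ ParabolicHom.oppNilRoots H lam)
    {E : Type*} [AddCommGroup E] [Module ℂ E] [LieRingModule L E] [LieModule ℂ L E]
    (hE : ParabolicHom.IsIrrepOfHighestWeight b γ E)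
    (φ : E →ₗ⁅ℂ, ParabolicHom.parabolic H lam⁆
      (L ⧸ (ParabolicHom.parabolic H lam).toLieSubmodule)) :
    φ = 0 := by
  open ParabolicHom in
  have := hE.irreducible
  obtain ⟨v, hv₀, hv, hv'⟩ := hE.exists_highestWeightVector
  have hvγ : v ∈ LieModule.weightSpace E (γ : H → ℂ) := (LieModule.mem_weightSpace _ _).mpr hv
  obtain ⟨x, hx, -, hφx⟩ := exists_rootVector_map_eq_mk φ hvγ
  have hx₀ : x = 0 := by
    by_contra hx₀
    obtain ⟨-, u, hu', y, hy, hy₀, huy⟩ :=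
      exists_ne_zero_of_chain φ hpos hγ.1 hβ hroot hvγ hx hx₀ hφx m le_rfl
    simp only [Fin.is_lt, Finset.filter_true] at hu' hy
    -- A nonzero `u` would be a weight vector of `E` whose weight is a long root, hence longer than
    -- `γ`.
    have hu₀ : u = 0 := by
      by_contra hu₀
      exact (sqLength_lt_of_isShortRoot_of_isLongRoot hlen hγ hlong).not_ge
        (hE.sqLength_le hdom hu₀ hu')
    rw [hu₀, map_zero] at huy
    have hyq : y ∈ parabolic H lam := by
      have := mk_eq_mk_iff.mp (huy.symm.trans (Submodule.Quotient.mk_zero _).symm)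
      rwa [sub_zero] at this
    exact hy₀ (eq_zero_of_mem_parabolic_of_mem_oppNilradical hyq
      (rootSpace_le_oppNilradical hu hy))
  have hφv : φ v = 0 := by rw [hφx, hx₀]; exact Submodule.Quotient.mk_zero _
  have hstable {y : L} (hy : y ∈ parabolic H lam) {u : E} (hu : φ u = 0) : φ ⁅y, u⁆ = 0 := by
    have := φ.map_lie ⟨y, hy⟩ u
    rw [hu, lie_zero] at this
    exact this
  have hker : LinearMap.ker φ.toLinearMap = ⊤ :=
    eq_top_of_lie_mem hv₀ hv hv' hφv (fun h _ hu ↦ hstable (coe_mem_parabolic lam h) hu)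
      (fun _ hα _ hy _ hu ↦
        hstable (rootSpace_le_parabolic (neg_mem_parabolicRoots hpos hα) hy) hu)
  ext u
  exact (hker ▸ Submodule.mem_top : u ∈ LinearMap.ker φ.toLinearMap)
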